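/- **Setting.** Graphs are finite, simple and undirected, on nodes $[n]$ ($n$ may differ from graph to graph), with adjacency matrix $A$ and node features $x_i\in\mathbb R^{d_0}$; an isomorphism of graphs preserves adjacency and features. $\sim$ is adjacency in $G$. *Policies.* $\Pi$ consists of node deletion, node marking, ego-nets of depth $h$ and marked ego-nets of depth $h$, for all $h>0$. A policy assigns to $G$ one subgraph $G^k=(V^k,E^k)$ of $G$ for each root $k\in[n]$: respectively $G$ without $k$; $G$; the subgraph induced on the nodes at distance at most $h$ from $k$ (both ego-net policies). $\sim_k$ is adjacency in $G^k$. It also gives initial representations $x^k_i$ for all $k,i\in[n]$: $x_i$ if $i\in V^k$; for $i\notin V^k$ one fixed convention is used throughout, either $x_i$ or $0$. Marking policies append one more channel, equal to $1$ if $i=k$ and to $0$ otherwise. The subgraphs together with the array $(x^k_i)$ form the bag $B$. *ReIGN(2).* A ReIGN(2) layer keeps the subgraphs and replaces $x^i_i$, resp. $x^k_i$ with $k\ne i$, by a bias vector plus the sum of the terms below, each multiplied by its own weight matrix; weights and biases for $x^i_i$ and for $x^k_i$ are separate, and do not depend on $n,i,k$. In brackets: global, subgraph-local and graph-local version, three separate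 terms. - For $x^i_i$: $x^i_i$; $[\sum_j,\sum_{j\sim_i i},\sum_{j\sim i}]\,x^j_j$; $[\sum_{j\ne i},\sum_{j\sim_i i},\sum_{j\sim i}]\,x^i_j$; $[\sum_{h\ne i},\sum_{h\sim_i i},\sum_{h\sim i}]\,x^h_i$; $[\sum_{h\neq j},\ \sum_{h\sim_i i}\sum_{j\sim_h h},\ \sum_{h\sim i}\sum_{j\sim h}]\,x^h_j$. - For $x^k_i$, $k\neq i$: $x^k_i$, $x^i_k$, $x^k_k$, $x^i_i$; $[\sum_{h\ne j},\ \sum_{h\sim_k i}\sum_{j\sim_h i},\ \sum_{h\sim i}\sum_{j\sim i}]\,x^h_j$; $[\sum_{h\neq i},\sum_{h\sim_k i},\sum_{h\sim i}]\,x^h_i$; $[\sum_{j\neq k},\sum_{j\sim_k i},\sum_{j\sim i}]\,x^k_j$; $[\sum_{h\neq i},\sum_{h\sim_k i},\sum_{h\sim i}]\,x^i_h$; $[\sum_{h\neq k},\sum_{h\sim_k i},\sum_{h\sim i}]\,x^h_k$; $[\sum_j,\sum_{j\sim_k i},\sum_{j\sim i}]\,x^j_j$. A ReIGN(2) instance is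 $\mathcal R_{\rho,\Theta,\bar\pi}=\mu\circ\rho\circ\mathcal S\circ\bar\pi$, where $\bar\pi\in\Pi$, $\mathcal S=L^{(T)}\circ\sigma\circ\dots\circ\sigma\circ L^{(1)}$ with ReIGN(2) layers $L^{(t)}$ and pointwise nonlinearities $\sigma$ (arbitrary functions $\mathbb R\to\mathbb R$), $\rho:(G,B)\mapsto x_G$ is a pooling function and $\mu$ an MLP. *3-IGN.* An equivariant linear layer from order $a$ to order $b$ maps tensors in $\mathbb R^{n^a\times d}$ to tensors in $\mathbb R^{n^b\times d'}$ by $(LY)_q=\sum_{p\in[n]^a}W_{[p,q]}Y_p+\beta_{[q]}$, where the matrix $W_{[p,q]}$ depends only on which of the $a+b$ entries of $(p,q)$ are equal, and the bias $\beta_{[q]}$ only on which of the entries of $q$ are equal; the parameters do not depend on $n$. A 3-IGN instance is $m\circ h\circ L^{(T)}\circ\mathrm{ReLU}\circ\dots\circ\mathrm{ReLU}\circ L^{(1)}$ with equivariant linear layers $L^{(t)}$ whose outputs have order $1$, $2$ or $3$, an invariant linear layer $h$ (output order $0$), and a ReLU MLP $m$. A graph is input as the tensor in $\mathbb R^{n^2\times(1+d_0)}$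 with $A$ in the first channel and the node features on the diagonal of the others. A pair $(G,B)$ is input as the order-3 tensor with entries $(k,i,j)$ that holds, in separate channels, $1_{i\sim_k j}$ and $1_{i\sim j}$, and on the entries with $i=j$ also $1_{i\in V^k}$, $x_i$ and $x^k_i$. The pooling $\rho$ is 3-IGN-computable if on every finite set of inputs $(G,B)$ it agrees with some 3-IGN instance (in particular if one instance computes it on all inputs); then it is permutation invariant. An instance distinguishes $G_1,G_2$ if its values on them differ. **Proposition 1.** Let $G_1,G_2$ be non-isomorphic graphs with features in $\mathbb R^{d_0}$. If there exist a policy $\bar\pi\in\Pi$, parameters $\Theta$ and a 3-IGN-computable invariant pooling function $\rho$ such that the ReIGN(2) instance $\mathcal R_{\rho,\Theta,\bar\pi}$ distinguishes $G_1,G_2$, then there exist weights $\Omega$ such that the 3-IGN instance $\mathcal M_\Omega$ distinguishes $G_1,G_2$. -/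

import Mathlib

namespace SubgraphGNN

/-! ## Graphs and bags of subgraphs -/

/-- A finite, simple, undirected graph on the nodes `Fin n`, with node features in `ℝ ^ d`. -/
structure AttrGraph (d : ℕ) where
  n : ℕ
  graph : SimpleGraph (Fin n)
  feat : Fin n → Fin d → ℝ

/-- Isomorphism of attributed graphs: a graph isomorphism that preserves the node features. -/
def AttrGraph.Isomorphic {d : ℕ} (G H : AttrGraph d) : Prop :=
  ∃ e : G.graph ≃g H.graph, ∀ v, H.feat (e v) = G.feat v

/-- A node-based bag of subgraphs of `G`, one subgraph for each root node `k`.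
`feat k i` is the representation `x^k_i` of node `i` in subgraph `k`. -/
structure Bag {d₀ : ℕ} (G : AttrGraph d₀) (d : ℕ) where
  sub : Fin G.n → G.graph.Subgraph
  feat : Fin G.n → Fin G.n → Fin d → ℝ

/-! ## The selection policies -/

/-- The class `Π`: node deletion, node marking, ego-nets and marked ego-nets of depth `h > 0`. -/
inductive Policy : Type
  | nodeDeletion : Policy
  | nodeMarking : Policy
  | ego (h : ℕ) (hpos : 0 < h) : Policy
  | egoMarked (h : ℕ) (hpos : 0 < h) : Policy

namespace Policy

/-- The subgraph of `G` selected for the root `v`. -/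
def select {V : Type} (G : SimpleGraph V) (v : V) : Policy → G.Subgraph
  | nodeDeletion => (⊤ : G.Subgraph).deleteVerts {v}
  | nodeMarking => ⊤
  | ego h _ => (⊤ : G.Subgraph).induce {u | G.edist v u ≤ (h : ℕ∞)}
  | egoMarked h _ => (⊤ : G.Subgraph).induce {u | G.edist v u ≤ (h : ℕ∞)}

/-- The number of feature channels in the bag: marking policies add one channel. -/
def outDim (d : ℕ) : Policy → ℕ
  | nodeDeletion => d
  | nodeMarking => d + 1
  | ego _ _ => d
  | egoMarked _ _ => d + 1

open Classical in
/-- The features of node `i` in the subgraph of root `k`, before marking.  The bag has a slot for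
every node; the slot of a node that is not in the subgraph keeps the original features of the node
(`zeroPad = false`) or is filled with zeros (`zeroPad = true`). -/
noncomputable def baseFeat {d : ℕ} (zeroPad : Bool) (π : Policy) (G : AttrGraph d)
    (k i : Fin G.n) : Fin d → ℝ :=
  if zeroPad = true ∧ i ∉ (π.select G.graph k).verts then 0 else G.feat i

/-- The features in the bag; marking policies append `1` for the root and `0` for all others. -/
noncomputable def initFeat {d : ℕ} (zeroPad : Bool) (G : AttrGraph d) (k i : Fin G.n) :
    (π : Policy) → Fin (π.outDim d) → ℝ
  | nodeDeletion => baseFeat zeroPad nodeDeletion G k i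
  | nodeMarking =>
      Fin.snoc (α := fun _ => ℝ) (baseFeat zeroPad nodeMarking G k i) (if i = k then 1 else 0)
  | ego h hpos => baseFeat zeroPad (ego h hpos) G k i
  | egoMarked h hpos =>
      Fin.snoc (α := fun _ => ℝ) (baseFeat zeroPad (egoMarked h hpos) G k i)
        (if i = k then 1 else 0)

/-- The bag of subgraphs that the policy generates from `G`. -/
noncomputable def bag {d : ℕ} (zeroPad : Bool) (π : Policy) (G : AttrGraph d) :
    Bag G (π.outDim d) where
  sub k := π.select G.graph k
  feat k i := initFeat zeroPad G k i π

end Policy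

/-! ## Multi-layer perceptrons -/

/-- Parameters of an MLP: affine maps, with an activation between consecutive ones. -/
inductive MLP (e : ℕ) : ℕ → Type
  | last {d : ℕ} (W : Matrix (Fin e) (Fin d) ℝ) (b : Fin e → ℝ) : MLP e d
  | step {d d' : ℕ} (W : Matrix (Fin d') (Fin d) ℝ) (b : Fin d' → ℝ) (rest : MLP e d') : MLP e d

/-- The MLP with output dimension `e`, evaluated with the activation function `φ`. -/
noncomputable def MLP.eval {e : ℕ} (φ : ℝ → ℝ) :
    {d : ℕ} → MLP e d → (Fin d → ℝ) → (Fin e → ℝ)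
  | _, .last W b, x => W.mulVec x + b
  | _, .step W b rest, x => rest.eval φ (fun c => φ ((W.mulVec x + b) c))

/-- The rectified linear unit. -/
noncomputable def relu (x : ℝ) : ℝ := max x 0

/-! ## Invariant graph networks of order 3 -/

/-- Tensors in `ℝ ^ (n ^ k × d)`. -/
abbrev Tensor (n k d : ℕ) : Type := (Fin k → Fin n) → Fin d → ℝ

/-- Parameters of an affine `S_n`-equivariant layer from order `a` and `d` channels to order `b`
and `d'` channels: one matrix for each equality pattern of `a + b` indices (each element of the
basis of equivariant linear maps), one bias vector for each equality pattern of `b` indices.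
The parameters do not depend on `n`. -/
structure EquivLayer (a d b d' : ℕ) where
  weight : Setoid (Fin a ⊕ Fin b) → Matrix (Fin d') (Fin d) ℝ
  bias : Setoid (Fin b) → Fin d' → ℝ

/-- The layer as a map of tensors: `Setoid.ker (Sum.elim p q)` is the equality pattern of the
multi-index made of the input multi-index `p` and the output multi-index `q`. -/
noncomputable def EquivLayer.eval {a d b d' n : ℕ} (L : EquivLayer a d b d') (Y : Tensor n a d) :
    Tensor n b d' :=
  fun q => (∑ p : Fin a → Fin n, (L.weight (Setoid.ker (Sum.elim p q))).mulVec (Y p)) +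
    L.bias (Setoid.ker q)

/-- Parameters of a stacking `L_T ∘ σ ∘ ⋯ ∘ σ ∘ L_1` of equivariant layers of orders `1`, `2`, `3`,
with outputs of order `b` with `e` channels. -/
inductive IGNStack (b e : ℕ) : ℕ → ℕ → Type
  | last {a d : ℕ} (hb : 1 ≤ b ∧ b ≤ 3) (L : EquivLayer a d b e) : IGNStack b e a d
  | step {a d k d' : ℕ} (hk : 1 ≤ k ∧ k ≤ 3) (L : EquivLayer a d k d')
      (rest : IGNStack b e k d') : IGNStack b e a d

/-- The stacking as a map of tensors, with ReLU between consecutive layers. -/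
noncomputable def IGNStack.eval {b e n : ℕ} :
    {a d : ℕ} → IGNStack b e a d → Tensor n a d → Tensor n b e
  | _, _, .last _ L, Y => L.eval Y
  | _, _, .step _ L rest, Y => rest.eval (fun q c => relu (L.eval Y q c))

/-- An instance `m ∘ h ∘ I` of a 3-IGN on inputs of order `a` with `d` channels: `I` is a stacking
of equivariant layers, `h` an invariant linear layer, `m` an MLP. -/
structure IGN3 (a d out : ℕ) where
  order : ℕ
  channels : ℕ
  hidden : ℕ
  stack : IGNStack order channels a d
  inv : EquivLayer order channels 0 hidden
  mlp : MLP out hidden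

/-- The function that a 3-IGN instance computes. -/
noncomputable def IGN3.eval {a d out n : ℕ} (M : IGN3 a d out) (Y : Tensor n a d) : Fin out → ℝ :=
  M.mlp.eval relu (M.inv.eval (M.stack.eval Y) Fin.elim0)

open Classical in
/-- The tensor in `ℝ ^ (n ^ 2 × (1 + d))` by which a graph is given to a 3-IGN: the adjacency matrix
in the first channel, the node features in the diagonal entries of the others. -/
noncomputable def AttrGraph.tensor {d : ℕ} (G : AttrGraph d) : Tensor G.n 2 (1 + d) := fun p =>
  Fin.append ![if G.graph.Adj (p 0) (p 1) then 1 else 0]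
    (if p 0 = p 1 then G.feat (p 0) else 0)

/-- The value of a 3-IGN instance on a graph. -/
noncomputable def IGN3.onGraph {d out : ℕ} (M : IGN3 2 (1 + d) out) (G : AttrGraph d) :
    Fin out → ℝ :=
  M.eval G.tensor

/-! ## ReIGN(2) layers -/

section Aggregation

open Classical in
/-- The aggregated terms in the update of the root representation `x^i_i`.  Each row has the global
version, the local one along the connectivity of a subgraph, and the local one along the
connectivity of the original graph. -/
noncomputable def Bag.aggOn {d₀ d : ℕ} {G : AttrGraph d₀} (B : Bag G d) (i : Fin G.n) :
    Fin 4 → Fin 3 → Fin d → ℝ :=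
  let x := B.feat
  ![![∑ j, x j j,
      ∑ j with (B.sub i).Adj j i, x j j,
      ∑ j with G.graph.Adj j i, x j j],
    ![∑ j with j ≠ i, x i j,
      ∑ j with (B.sub i).Adj j i, x i j,
      ∑ j with G.graph.Adj j i, x i j],
    ![∑ h with h ≠ i, x h i,
      ∑ h with (B.sub i).Adj h i, x h i,
      ∑ h with G.graph.Adj h i, x h i],
    ![∑ h, ∑ j with j ≠ h, x h j,
      ∑ h with (B.sub i).Adj h i, ∑ j with (B.sub h).Adj j h, x h j,
      ∑ h with G.graph.Adj h i, ∑ j with G.graph.Adj j h, x h j]]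

/-- The non-aggregated terms in the update of the non-root representation `x^k_i`, `k ≠ i`. -/
def Bag.pointOff {d₀ d : ℕ} {G : AttrGraph d₀} (B : Bag G d) (k i : Fin G.n) :
    Fin 4 → Fin d → ℝ :=
  ![B.feat k i, B.feat i k, B.feat k k, B.feat i i]

open Classical in
/-- The aggregated terms in the update of the non-root representation `x^k_i`, `k ≠ i`.  Each row
has the global version, the local one along the connectivity of a subgraph, and the local one along
the connectivity of the original graph. -/
noncomputable def Bag.aggOff {d₀ d : ℕ} {G : AttrGraph d₀} (B : Bag G d) (k i : Fin G.n) :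
    Fin 6 → Fin 3 → Fin d → ℝ :=
  let x := B.feat
  ![![∑ h, ∑ j with j ≠ h, x h j,
      ∑ h with (B.sub k).Adj h i, ∑ j with (B.sub h).Adj j i, x h j,
      ∑ h with G.graph.Adj h i, ∑ j with G.graph.Adj j i, x h j],
    ![∑ h with h ≠ i, x h i,
      ∑ h with (B.sub k).Adj h i, x h i,
      ∑ h with G.graph.Adj h i, x h i],
    ![∑ j with j ≠ k, x k j,
      ∑ j with (B.sub k).Adj j i, x k j,
      ∑ j with G.graph.Adj j i, x k j],
    ![∑ h with h ≠ i, x i h,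
      ∑ h with (B.sub k).Adj h i, x i h,
      ∑ h with G.graph.Adj h i, x i h],
    ![∑ h with h ≠ k, x h k,
      ∑ h with (B.sub k).Adj h i, x h k,
      ∑ h with G.graph.Adj h i, x h k],
    ![∑ j, x j j,
      ∑ j with (B.sub k).Adj j i, x j j,
      ∑ j with G.graph.Adj j i, x j j]]

end Aggregation

/-- Parameters of a ReIGN(2) layer: one matrix for each term, and a bias, separately for the update
of root and of non-root representations. -/
structure ReIGNLayer (d d' : ℕ) where
  selfOn : Matrix (Fin d') (Fin d) ℝ
  aggOn : Fin 4 → Fin 3 → Matrix (Fin d') (Fin d) ℝ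
  biasOn : Fin d' → ℝ
  pointOff : Fin 4 → Matrix (Fin d') (Fin d) ℝ
  aggOff : Fin 6 → Fin 3 → Matrix (Fin d') (Fin d) ℝ
  biasOff : Fin d' → ℝ

/-- A ReIGN(2) layer updates the features of the bag and keeps the connectivity. -/
noncomputable def ReIGNLayer.eval {d₀ d d' : ℕ} {G : AttrGraph d₀} (L : ReIGNLayer d d')
    (B : Bag G d) : Bag G d' where
  sub := B.sub
  feat k i :=
    if k = i then
      L.selfOn.mulVec (B.feat i i) + (∑ t, ∑ s, (L.aggOn t s).mulVec (B.aggOn i t s)) + L.biasOn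
    else
      (∑ t, (L.pointOff t).mulVec (B.pointOff k i t)) +
        (∑ t, ∑ s, (L.aggOff t s).mulVec (B.aggOff k i t s)) + L.biasOff

/-- A pointwise function, applied to the features of the bag. -/
def Bag.map {d₀ d : ℕ} {G : AttrGraph d₀} (φ : ℝ → ℝ) (B : Bag G d) : Bag G d where
  sub := B.sub
  feat k i c := φ (B.feat k i c)

/-- A stacking `L_T ∘ σ ∘ ⋯ ∘ σ ∘ L_1` of ReIGN(2) layers; each `σ` is a pointwise nonlinearity. -/
inductive ReIGNStack (e : ℕ) : ℕ → Type
  | last {d : ℕ} (L : ReIGNLayer d e) : ReIGNStack e d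
  | step {d d' : ℕ} (L : ReIGNLayer d d') (σ : ℝ → ℝ) (rest : ReIGNStack e d') : ReIGNStack e d

/-- The stacking as a map of bags. -/
noncomputable def ReIGNStack.eval {d₀ e : ℕ} {G : AttrGraph d₀} :
    {d : ℕ} → ReIGNStack e d → Bag G d → Bag G e
  | _, .last L, B => L.eval B
  | _, .step L σ rest, B => rest.eval ((L.eval B).map σ)

/-! ## Pooling functions and ReIGN(2) models -/

/-- A pooling function `(G, B) ↦ x_G`, on graphs with bags of subgraphs. -/
abbrev Pooling (d₀ d q : ℕ) : Type := (G : AttrGraph d₀) → Bag G d → Fin q → ℝ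

open Classical in
/-- The cubed tensor in `ℝ ^ (n ^ 3 × c)` by which a graph and a bag of subgraphs are given to a
3-IGN.  The first axis indexes the subgraphs, the other two the nodes.  The entries `(k, i, j)` with
`i ≠ j` hold the connectivity of subgraph `k` and the one of `G`; the entries `(k, i, i)` hold the
membership of node `i` in subgraph `k`, the features of `i` in `G`, and those in subgraph `k`. -/
noncomputable def Bag.tensor {d₀ d : ℕ} {G : AttrGraph d₀} (B : Bag G d) :
    Tensor G.n 3 (3 + (d₀ + d)) := fun p =>
  Fin.append
    ![if (B.sub (p 0)).Adj (p 1) (p 2) then 1 else 0,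
      if G.graph.Adj (p 1) (p 2) then 1 else 0,
      if p 1 = p 2 ∧ p 1 ∈ (B.sub (p 0)).verts then 1 else 0]
    (if p 1 = p 2 then Fin.append (G.feat (p 1)) (B.feat (p 0) (p 1)) else 0)

/-- A pooling function is 3-IGN-computable if on every finite set of inputs it is implemented by a
3-IGN instance.  As 3-IGN instances are invariant, so is such a pooling function.  A pooling function
that one 3-IGN instance implements on all inputs is a special case. -/
def Pooling.IGN3Computable {d₀ d q : ℕ} (ρ : Pooling d₀ d q) : Prop :=
  ∀ D : Set ((G : AttrGraph d₀) × Bag G d), D.Finite →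
    ∃ M : IGN3 3 (3 + (d₀ + d)) q, ∀ I ∈ D, ρ I.1 I.2 = M.eval I.2.tensor

/-- A ReIGN(2) instance `μ ∘ ρ ∘ S ∘ π`: a policy `π` in the class `Π` (with a convention for the
features of nodes outside a subgraph), a stacking `S` of ReIGN(2) layers, a pooling function `ρ`,
and an MLP `μ` with its activation function. -/
structure ReIGN (d₀ out : ℕ) where
  policy : Policy
  zeroPad : Bool
  channels : ℕ
  stack : ReIGNStack channels (policy.outDim d₀)
  hidden : ℕ
  pool : Pooling d₀ channels hidden
  act : ℝ → ℝ
  mlp : MLP out hidden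

/-- The function that a ReIGN(2) instance computes. -/
noncomputable def ReIGN.eval {d₀ out : ℕ} (R : ReIGN d₀ out) (G : AttrGraph d₀) : Fin out → ℝ :=
  R.mlp.eval R.act (R.pool G (R.stack.eval (R.policy.bag R.zeroPad G)))

end SubgraphGNN

namespace SubgraphGNN

/-! ## Interpolation by ReLU networks -/

/-! The argument is a colour refinement argument on the triples of nodes of both graphs at once.
Among the colourings of triples that a stack of order-3 layers computes and that refine the input,
choose one whose partition is as fine as possible. Since ReLU networks interpolate arbitrary
functions on finite sets, any equivariant linear map that split a colour class could be appended to
the stack. So the chosen colouring is stable: equivariant linear maps send functions of the colour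
to functions of the colour (`exists_isStable`).

Stability makes functions of the colour closed under permuting and repeating the three nodes and
under summing out one of them. Equality, adjacency and bounded distance are such functions, hence so
are the selected subgraphs, the initial features, every ReIGN(2) layer with any nonlinearity
(`reignStack`), and the tensor given to the pooling. A 3-IGN on this tensor takes one value on any
two graphs that share a colour (`ign3`).

As the ReIGN(2) instance distinguishes the graphs, they share no colour. The indicator of one graph
is then a computable function of triples, and its sum separates the graphs (`exists_ign3`). -/

theorem relu_of_nonneg {x : ℝ} (hx : 0 ≤ x) : relu x = x := max_eq_left hx

theorem relu_of_nonpos {x : ℝ} (hx : x ≤ 0) : relu x = 0 := max_eq_right hx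

theorem exists_sum_relu_eq {e : ℕ} (φ : ℝ → Fin e → ℝ) (s : Finset ℝ) :
    ∃ (m : ℕ) (t : Fin m → ℝ) (c : Fin m → Fin e → ℝ),
      ∀ x ∈ s, ∑ i, relu (x - t i) • c i = φ x := by
  induction s using Finset.induction_on_max with
  | empty => exact ⟨0, Fin.elim0, Fin.elim0, by simp⟩
  | insert a s ha ih =>
    obtain ⟨m, t, c, h⟩ := ih
    obtain ⟨t₀, ht₀, hs⟩ : ∃ t₀ < a, ∀ x ∈ s, x ≤ t₀ := by
      rcases s.eq_empty_or_nonempty with rfl | hne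
      · exact ⟨a - 1, by linarith, by simp⟩
      · exact ⟨s.max' hne, ha _ (s.max'_mem hne), fun x hx => s.le_max' x hx⟩
    -- The new knot lies below `a` but not below any point of `s`: its unit vanishes on `s`, and its
    -- coefficient corrects the value at `a`.
    refine ⟨m + 1, Fin.cons t₀ t,
      Fin.cons ((a - t₀)⁻¹ • (φ a - ∑ i, relu (a - t i) • c i)) c, fun x hx => ?_⟩
    rw [Fin.sum_univ_succ]
    simp only [Fin.cons_zero, Fin.cons_succ]
    rcases Finset.mem_insert.1 hx with rfl | hx
    · rw [relu_of_nonneg (by linarith), smul_smul, mul_inv_cancel₀ (by linarith), one_smul,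
        sub_add_cancel]
    · rw [relu_of_nonpos (by linarith [hs x hx]), zero_smul, zero_add, h x hx]

/-- The differences of distinct points are finitely many nonzero vectors, and over an infinite field
some linear functional vanishes on none of them. This reduces interpolation to one real variable. -/
theorem exists_injOn_dotProduct {d : ℕ} (S : Set (Fin d → ℝ)) (hS : S.Finite) :
    ∃ w : Fin d → ℝ, S.InjOn (fun x => w ⬝ᵥ x) := by
  have : Finite S := hS
  obtain ⟨f, hf⟩ := Module.exists_dual_forall_apply_ne_zero (K := ℝ)
    (fun p : {p : S × S // p.1 ≠ p.2} => (p.1.1 : Fin d → ℝ) - p.1.2)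
    (fun p => sub_ne_zero.2 fun h => p.2 (Subtype.ext h))
  refine ⟨fun i => f (Pi.single i 1), fun x hx y hy hxy => ?_⟩
  by_contra hne
  refine hf ⟨(⟨x, hx⟩, ⟨y, hy⟩), fun h => hne (congrArg Subtype.val h)⟩ ?_
  have key : ∀ z, f z = (fun i => f (Pi.single i 1)) ⬝ᵥ z := fun z => by
    rw [LinearMap.pi_apply_eq_sum_univ f z, dotProduct]
    refine Finset.sum_congr rfl fun i _ => ?_
    rw [smul_eq_mul, mul_comm]
    congr 2
    ext j
    simp [Pi.single_apply, eq_comm]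
  rw [map_sub, key, key, sub_eq_zero]
  exact hxy

theorem exists_relu_interpolation {d e : ℕ} (S : Set (Fin d → ℝ)) (hS : S.Finite)
    (φ : (Fin d → ℝ) → Fin e → ℝ) :
    ∃ (m : ℕ) (W₁ : Matrix (Fin m) (Fin d) ℝ) (b : Fin m → ℝ) (W₂ : Matrix (Fin e) (Fin m) ℝ),
      ∀ x ∈ S, W₂.mulVec (fun i => relu ((W₁.mulVec x + b) i)) = φ x := by
  obtain ⟨w, hw⟩ := exists_injOn_dotProduct S hS
  obtain ⟨m, t, c, h⟩ := exists_sum_relu_eq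
    (fun y => φ (Function.invFunOn (fun x => w ⬝ᵥ x) S y)) (hS.image fun x => w ⬝ᵥ x).toFinset
  refine ⟨m, .of fun _ => w, fun i => -t i, .of fun j i => c i j, fun x hx => ?_⟩
  have hx' := h (w ⬝ᵥ x) (by simpa using ⟨x, hx, rfl⟩)
  rw [hw.leftInvOn_invFunOn hx] at hx'
  rw [← hx']
  ext j
  simp only [Matrix.mulVec, dotProduct, Finset.sum_apply, Pi.smul_apply, smul_eq_mul, Pi.add_apply,
    Matrix.of_apply]
  refine Finset.sum_congr rfl fun i _ => ?_
  rw [mul_comm, sub_eq_add_neg]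

/-! ## Composition of stackings with further layers -/

/-- The affine map is absorbed into the last layer, so no ReLU comes between. -/
theorem IGNStack.exists_affine {b e a d e' : ℕ} (s : IGNStack b e a d)
    (W : Matrix (Fin e') (Fin e) ℝ) (v : Fin e' → ℝ) :
    ∃ s' : IGNStack b e' a d, ∀ {n : ℕ} (Y : Tensor n a d) (q : Fin b → Fin n),
      s'.eval Y q = W.mulVec (s.eval Y q) + v := by
  induction s with
  | last hb L =>
    refine ⟨.last hb ⟨fun S => W * L.weight S, fun S => W.mulVec (L.bias S) + v⟩,
      fun Y q => ?_⟩
    simp only [IGNStack.eval, EquivLayer.eval, Matrix.mulVec_add, Matrix.mulVec_sum,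
      Matrix.mulVec_mulVec, add_assoc]
  | step hk L rest ih =>
    obtain ⟨s', h⟩ := ih
    exact ⟨.step hk L s', fun Y q => h _ q⟩

theorem IGNStack.exists_snoc {b e a d k d' : ℕ} (s : IGNStack b e a d) (hk : 1 ≤ k ∧ k ≤ 3)
    (L : EquivLayer b e k d') :
    ∃ s' : IGNStack k d' a d, ∀ {n : ℕ} (Y : Tensor n a d) (q : Fin k → Fin n),
      s'.eval Y q = L.eval (fun p c => relu (s.eval Y p c)) q := by
  induction s with
  | last hb L' => exact ⟨.step hb L' (.last hk L), fun Y q => rfl⟩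
  | step hk' L' rest ih =>
    obtain ⟨s', h⟩ := ih
    exact ⟨.step hk' L' s', fun Y q => h _ q⟩

/-- The layer that applies a matrix at every entry. -/
noncomputable def EquivLayer.pointwise (k : ℕ) {d d' : ℕ} (W : Matrix (Fin d') (Fin d) ℝ) :
    EquivLayer k d k d' :=
  open Classical in ⟨fun S => if ∀ i, S (.inl i) (.inr i) then W else 0, fun _ => 0⟩

theorem EquivLayer.pointwise_eval {n k d d' : ℕ} (W : Matrix (Fin d') (Fin d) ℝ)
    (Y : Tensor n k d) (q : Fin k → Fin n) :
    (EquivLayer.pointwise k W).eval Y q = W.mulVec (Y q) := by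
  classical
  have h : ∀ p : Fin k → Fin n,
      (∀ i, Setoid.ker (Sum.elim p q) (.inl i) (.inr i)) ↔ p = q := fun p => by
    simp [funext_iff]
  simp only [EquivLayer.eval, EquivLayer.pointwise, add_zero]
  rw [Finset.sum_eq_single q]
  · rw [if_pos ((h q).2 rfl)]
  · intro p _ hp
    rw [if_neg (mt (h p).1 hp), Matrix.zero_mulVec]
  · simp

/-! ## Stable colourings of the triples of nodes of a family of graphs -/

section Stable

variable {ι : Type} {d₀ : ℕ}

/-- The triples of nodes of the graphs of a family. -/
abbrev Triple (G : ι → AttrGraph d₀) : Type := Σ g, Fin 3 → Fin (G g).n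

/-- A function of triples of nodes is computable if some stacking of equivariant layers
computes it. -/
def Computable (G : ι → AttrGraph d₀) {d : ℕ} (F : Triple G → Fin d → ℝ) : Prop :=
  ∃ s : IGNStack 3 d 2 (1 + d₀), ∀ x : Triple G, s.eval (G x.1).tensor x.2 = F x

/-- The input tensor at the first two nodes of a triple. -/
noncomputable def inputAt (G : ι → AttrGraph d₀) (x : Triple G) : Fin (1 + d₀) → ℝ :=
  (G x.1).tensor fun i => x.2 (Fin.castLE (by decide) i)

/-- The equivariant linear map on scalar tensors of order `3` with coefficients `w`. -/
noncomputable def weightedSum {G : ι → AttrGraph d₀} (w : Setoid (Fin 3 ⊕ Fin 3) → ℝ)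
    (f : Triple G → ℝ) (x : Triple G) : ℝ :=
  ∑ p : Fin 3 → Fin (G x.1).n, w (Setoid.ker (Sum.elim p x.2)) * f ⟨x.1, p⟩

variable {G : ι → AttrGraph d₀}

theorem computable_inputAt : Computable G (inputAt G) := by
  classical
  refine ⟨.last (by decide) ⟨fun S => if ∀ i : Fin 2, S (.inl i) (.inr (Fin.castLE (by decide) i))
    then 1 else 0, fun _ => 0⟩, fun x => ?_⟩
  have h : ∀ p : Fin 2 → Fin (G x.1).n,
      (∀ i : Fin 2, Setoid.ker (Sum.elim p x.2) (.inl i) (.inr (Fin.castLE (by decide) i))) ↔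
        p = fun i => x.2 (Fin.castLE (by decide) i) := fun p => by
    simp [funext_iff]
  simp only [IGNStack.eval, EquivLayer.eval, add_zero]
  rw [Finset.sum_eq_single fun i => x.2 (Fin.castLE (by decide) i)]
  · rw [if_pos ((h _).2 rfl), Matrix.one_mulVec, inputAt]
  · intro p _ hp
    rw [if_neg (mt (h p).1 hp), Matrix.zero_mulVec]
  · simp

/-- A layer after a computable function with nonnegative values. -/
theorem Computable.layer {d d' : ℕ} {F : Triple G → Fin d → ℝ} (hF : Computable G F)
    (hpos : ∀ x c, 0 ≤ F x c) (L : EquivLayer 3 d 3 d') :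
    Computable G fun x => L.eval (fun p => F ⟨x.1, p⟩) x.2 := by
  obtain ⟨s, hs⟩ := hF
  obtain ⟨s', hs'⟩ := s.exists_snoc (by decide) L
  refine ⟨s', fun x => ?_⟩
  rw [hs']
  congr 1
  funext p c
  rw [hs ⟨x.1, p⟩, relu_of_nonneg (hpos _ _)]

/-- On a finite family, every function of a computable function is computable. -/
theorem Computable.of_factors [Finite ι] {d e : ℕ} {F : Triple G → Fin d → ℝ}
    (hF : Computable G F) {H : Triple G → Fin e → ℝ} (h : ∀ x y, F x = F y → H x = H y) :
    Computable G H := by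
  obtain ⟨s, hs⟩ := hF
  obtain ⟨m, W₁, b, W₂, hφ⟩ := exists_relu_interpolation (Set.range F) (Set.finite_range F)
    -- By `h`, `H` descends to the range of `F`; the value `0` elsewhere plays no role.
    (Function.extend F H 0)
  obtain ⟨s₁, hs₁⟩ := s.exists_affine W₁ b
  obtain ⟨s₂, hs₂⟩ := s₁.exists_snoc (by decide) (.pointwise 3 W₂)
  refine ⟨s₂, fun x => ?_⟩
  rw [hs₂, EquivLayer.pointwise_eval, hs₁, hs x, hφ _ ⟨x, rfl⟩]
  exact Function.FactorsThrough.extend_apply (fun x y => h x y) _ x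

/-- Recodes vector values as single reals, so that every colouring has one channel. -/
theorem exists_ker_eq {α β : Type*} [Finite α] (F : α → β) :
    ∃ c : α → ℝ, ∀ x y, c x = c y ↔ F x = F y := by
  obtain ⟨k, ⟨e⟩⟩ := Finite.exists_equiv_fin (Set.range F)
  exact ⟨fun x => (e ⟨F x, x, rfl⟩ : ℕ), fun x y => by simp [Fin.val_inj, Subtype.ext_iff]⟩

/-- A computable colouring of the triples of nodes that refines the input and that equivariant
layers do not refine any further. -/
structure IsStable (G : ι → AttrGraph d₀) (c : Triple G → ℝ) : Prop where
  computable : Computable G fun x => ![c x]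
  inputAt_eq : ∀ x y, c x = c y → inputAt G x = inputAt G y
  weightedSum_eq : ∀ (w : Setoid (Fin 3 ⊕ Fin 3) → ℝ) (f : Triple G → ℝ),
    (∀ x y, c x = c y → f x = f y) → ∀ x y, c x = c y → weightedSum w f x = weightedSum w f y

variable (G) in
theorem exists_isStable [Finite ι] : ∃ c : Triple G → ℝ, IsStable G c := by
  -- There are finitely many partitions of the triples, so a minimal one exists among those of
  -- computable colourings that refine the input.
  let K : Set (Setoid (Triple G)) := {S | ∃ c : Triple G → ℝ, Setoid.ker c = S ∧
    Computable G (fun x => ![c x]) ∧ ∀ x y, c x = c y → inputAt G x = inputAt G y}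
  have hK : K.Nonempty := by
    obtain ⟨c, hc⟩ := exists_ker_eq (inputAt G)
    exact ⟨_, c, rfl, computable_inputAt.of_factors fun x y h => by rw [(hc x y).2 h],
      fun x y h => (hc x y).1 h⟩
  have : Finite (Setoid (Triple G)) :=
    Finite.of_injective (fun S : Setoid (Triple G) => fun x y => S x y) fun S T h =>
      Setoid.ext fun x y => iff_of_eq (congrFun (congrFun h x) y)
  obtain ⟨_, ⟨c, rfl, hc, hin⟩, hmin⟩ := K.toFinite.exists_minimal hK
  -- Nonnegative `f` comes first, because a ReLU precedes the appended layer. For the same reason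
  -- `c` is carried along as `exp c`, a nonnegative injective recoding.
  have pos : ∀ (w : Setoid (Fin 3 ⊕ Fin 3) → ℝ) (f : Triple G → ℝ), (∀ x, 0 ≤ f x) →
      (∀ x y, c x = c y → f x = f y) → ∀ x y, c x = c y → weightedSum w f x = weightedSum w f y := by
    intro w f hf hcf
    classical
    have h₁ : Computable G fun x => ![Real.exp (c x), f x] :=
      hc.of_factors fun x y h => by
        have h' : c x = c y := congrFun h 0
        rw [h', hcf x y h']
    -- Block-diagonal layer: the first channel is copied, the second undergoes the map with
    -- coefficients `w`.
    have h₂ := h₁.layer (fun x i => by fin_cases i <;> simp [hf, Real.exp_nonneg])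
      (⟨fun S => !![if ∀ i, S (.inl i) (.inr i) then 1 else 0, 0; 0, w S], fun _ => 0⟩ :
        EquivLayer 3 2 3 2)
    obtain ⟨c', hc'⟩ := exists_ker_eq fun x => ![Real.exp (c x), weightedSum w f x]
    have h₃ : Computable G fun x => ![c' x] := by
      refine h₂.of_factors fun x y h => ?_
      have key : ∀ x : Triple G, (⟨fun S => !![if ∀ i, S (.inl i) (.inr i) then 1 else 0, 0; 0, w S],
          fun _ => 0⟩ : EquivLayer 3 2 3 2).eval (fun p => ![Real.exp (c ⟨x.1, p⟩), f ⟨x.1, p⟩]) x.2 =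
          ![Real.exp (c x), weightedSum w f x] := fun x => by
        funext i
        fin_cases i
        · simp [EquivLayer.eval, Finset.sum_apply, ← funext_iff]
        · simp [EquivLayer.eval, Finset.sum_apply, weightedSum, mul_comm]
      simp only [key] at h
      rw [(hc' x y).2 h]
    have hle : Setoid.ker c' ≤ Setoid.ker c := fun x y h =>
      Real.exp_injective (congrFun ((hc' x y).1 h) 0)
    -- `c'` refines `c`, so by minimality both have the same classes, and `weightedSum w f` is
    -- constant on them.
    have := hmin ⟨c', rfl, h₃, fun x y h => hin x y (hle h)⟩ hle
    exact fun x y h => congrFun ((hc' x y).1 (this h)) 1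
  refine ⟨c, hc, hin, fun w f hf x y h => ?_⟩
  -- By linearity, the general case follows from the positive and negative parts.
  have key : ∀ x, weightedSum w f x =
      weightedSum w (fun z => max (f z) 0) x - weightedSum w (fun z => max (-f z) 0) x := fun x => by
    simp only [weightedSum, ← Finset.sum_sub_distrib, ← mul_sub]
    refine Finset.sum_congr rfl fun p _ => ?_
    rcases le_total 0 (f ⟨x.1, p⟩) with h | h
    · rw [max_eq_left h, max_eq_right (by linarith), sub_zero]
    · rw [max_eq_right h, max_eq_left (by linarith), zero_sub, neg_neg]
  rw [key, key, pos w _ (fun _ => le_max_right _ _) (fun x y h => by rw [hf x y h]) x y h,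
    pos w _ (fun _ => le_max_right _ _) (fun x y h => by rw [hf x y h]) x y h]

end Stable

/-! ## Functions of the colours of a stable colouring -/

section Determined

variable {ι : Type} {d₀ : ℕ} {G : ι → AttrGraph d₀}

/-- A function of three nodes is determined by a colouring of the triples of nodes if triples with
the same colour, possibly in different graphs of the family, have the same value. -/
def Determined (c : Triple G → ℝ) {X : Type*}
    (f : ∀ g, Fin (G g).n → Fin (G g).n → Fin (G g).n → X) : Prop :=
  ∀ x y : Triple G, c x = c y →
    f x.1 (x.2 0) (x.2 1) (x.2 2) = f y.1 (y.2 0) (y.2 1) (y.2 2)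

namespace Determined

variable {c : Triple G → ℝ} {X Y Z : Type*}

theorem const (a : X) : Determined c fun _ _ _ _ => a := fun _ _ _ => rfl

theorem map {f : ∀ g, Fin (G g).n → Fin (G g).n → Fin (G g).n → X} (hf : Determined c f)
    (φ : X → Y) : Determined c fun g k i j => φ (f g k i j) :=
  fun x y h => congrArg φ (hf x y h)

theorem map₂ {f : ∀ g, Fin (G g).n → Fin (G g).n → Fin (G g).n → X} (hf : Determined c f)
    {f' : ∀ g, Fin (G g).n → Fin (G g).n → Fin (G g).n → Y} (hf' : Determined c f')
    (φ : X → Y → Z) : Determined c fun g k i j => φ (f g k i j) (f' g k i j) :=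
  fun x y h => congrArg₂ φ (hf x y h) (hf' x y h)

theorem pi {α : Type*} {X : α → Type*}
    {f : ∀ g, Fin (G g).n → Fin (G g).n → Fin (G g).n → ∀ a, X a}
    (hf : ∀ a, Determined c fun g k i j => f g k i j a) : Determined c f :=
  fun x y h => funext fun a => hf a x y h

theorem not {f : ∀ g, Fin (G g).n → Fin (G g).n → Fin (G g).n → Prop} (hf : Determined c f) :
    Determined c fun g k i j => ¬ f g k i j := hf.map Not

theorem ite {P : ∀ g, Fin (G g).n → Fin (G g).n → Fin (G g).n → Prop}
    [∀ g k i j, Decidable (P g k i j)] (hP : Determined c P)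
    {f : ∀ g, Fin (G g).n → Fin (G g).n → Fin (G g).n → X} (hf : Determined c f)
    {f' : ∀ g, Fin (G g).n → Fin (G g).n → Fin (G g).n → X} (hf' : Determined c f') :
    Determined c fun g k i j => if P g k i j then f g k i j else f' g k i j := by
  intro x y h
  have h₁ := hP x y h
  have h₂ := hf x y h
  have h₃ := hf' x y h
  simp only [h₁, h₂, h₃]

theorem add [Add X] {f : ∀ g, Fin (G g).n → Fin (G g).n → Fin (G g).n → X} (hf : Determined c f)
    {f' : ∀ g, Fin (G g).n → Fin (G g).n → Fin (G g).n → X} (hf' : Determined c f') :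
    Determined c fun g k i j => f g k i j + f' g k i j := hf.map₂ hf' (· + ·)

theorem finset_sum [AddCommMonoid X] {α : Type*} (s : Finset α)
    {f : α → ∀ g, Fin (G g).n → Fin (G g).n → Fin (G g).n → X} (hf : ∀ a, Determined c (f a)) :
    Determined c fun g k i j => ∑ a ∈ s, f a g k i j :=
  fun x y h => Finset.sum_congr rfl fun a _ => hf a x y h

end Determined

/-! ### Closure properties of the functions of a stable colour -/

namespace IsStable

variable {c : Triple G → ℝ}

theorem comp_eq (hc : IsStable G c) (s : Fin 3 → Fin 3) {x y : Triple G} (h : c x = c y) :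
    c ⟨x.1, x.2 ∘ s⟩ = c ⟨y.1, y.2 ∘ s⟩ := by
  classical
  -- The weights retain the single summand `p = x.2 ∘ s`, so the equivariant map reads off the
  -- colour there.
  have key : ∀ x : Triple G, weightedSum
      (fun S => if ∀ i, S (.inl i) (.inr (s i)) then 1 else 0) c x = c ⟨x.1, x.2 ∘ s⟩ := fun x => by
    have : ∀ p : Fin 3 → Fin (G x.1).n, (∀ i, p i = x.2 (s i)) ↔ p = x.2 ∘ s := fun p => by
      simp [funext_iff]
    simp [weightedSum, this]
  rw [← key, ← key]
  exact hc.weightedSum_eq _ c (fun _ _ => id) x y h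

theorem ker_eq (hc : IsStable G c) {x y : Triple G} (h : c x = c y) :
    Setoid.ker x.2 = Setoid.ker y.2 := by
  classical
  -- Coefficients also see the equality pattern of the output index, so a map applied to the
  -- constant `1` yields the indicator of a pattern.
  have key : ∀ z : Triple G, weightedSum
      (fun S => if (∀ i, S (.inl i) (.inr i)) ∧ S.comap Sum.inr = Setoid.ker x.2 then 1 else 0)
      (fun _ => 1) z = if Setoid.ker z.2 = Setoid.ker x.2 then 1 else 0 := fun z => by
    have h₁ : ∀ p : Fin 3 → Fin (G z.1).n, (Setoid.ker (Sum.elim p z.2)).comap Sum.inr =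
        Setoid.ker z.2 := fun p => by
      ext i j
      simp
    simp [weightedSum, h₁, ite_and, ← funext_iff]
  have := (key x).symm.trans ((hc.weightedSum_eq _ _ (fun _ _ _ => rfl) x y h).trans (key y))
  rw [if_pos rfl] at this
  by_contra hne
  simp [Ne.symm hne] at this

variable {X : Type*}

/-- Slots `0, 1, 2` stand for `k, i, j`. Combined with summation over the last slot, this makes any
of the three nodes available as the bound variable. -/
theorem subst (hc : IsStable G c) {f : ∀ g, Fin (G g).n → Fin (G g).n → Fin (G g).n → X}
    (hf : Determined c f) (a b e : Fin 3) :
    Determined c fun g k i j => f g (![k, i, j] a) (![k, i, j] b) (![k, i, j] e) := by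
  intro x y h
  have key : ∀ x : Triple G, ![x.2 0, x.2 1, x.2 2] = x.2 := fun x => by
    ext i
    fin_cases i <;> rfl
  simp only [key]
  exact hf _ _ (hc.comp_eq ![a, b, e] h)

theorem eq (hc : IsStable G c) : Determined c fun _ k i _ => k = i :=
  fun x y h => by simpa using congrArg (fun S : Setoid (Fin 3) => S 0 1) (hc.ker_eq h)

theorem sum_real (hc : IsStable G c) {f : ∀ g, Fin (G g).n → Fin (G g).n → Fin (G g).n → ℝ}
    (hf : Determined c f) : Determined c fun g k i _ => ∑ j, f g k i j := by
  classical
  -- Fixing the first two entries of `p` leaves a free sum over the third.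
  have key : ∀ x : Triple G, weightedSum
      (fun S => if S (.inl 0) (.inr 0) ∧ S (.inl 1) (.inr 1) then 1 else 0)
      (fun z => f z.1 (z.2 0) (z.2 1) (z.2 2)) x = ∑ j, f x.1 (x.2 0) (x.2 1) j := fun x => by
    simp only [weightedSum, ite_mul, one_mul, zero_mul]
    rw [← Finset.sum_filter]
    refine Finset.sum_bij' (fun p _ => p 2) (fun j _ => ![x.2 0, x.2 1, j]) ?_ ?_ ?_ ?_ ?_
    · simp
    · simp
    · intro p hp
      simp only [Finset.mem_filter, Setoid.ker_def, Sum.elim_inl, Sum.elim_inr] at hp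
      ext i
      fin_cases i <;> simp [hp]
    · simp
    · intro p hp
      simp only [Finset.mem_filter, Setoid.ker_def, Sum.elim_inl, Sum.elim_inr] at hp
      rw [hp.2.1, hp.2.2]
  intro x y h
  exact (key x).symm.trans ((hc.weightedSum_eq _ _ hf x y h).trans (key y))

theorem sum (hc : IsStable G c) {d : ℕ}
    {f : ∀ g, Fin (G g).n → Fin (G g).n → Fin (G g).n → Fin d → ℝ}
    (hf : Determined c f) : Determined c fun g k i _ => ∑ j, f g k i j :=
  .pi fun a => by
    simpa only [Finset.sum_apply] using hc.sum_real (hf.map fun v => v a)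

theorem sum_filter (hc : IsStable G c) {d : ℕ}
    {P : ∀ g, Fin (G g).n → Fin (G g).n → Fin (G g).n → Prop}
    [∀ g k i, DecidablePred (P g k i)] (hP : Determined c P)
    {f : ∀ g, Fin (G g).n → Fin (G g).n → Fin (G g).n → Fin d → ℝ} (hf : Determined c f) :
    Determined c fun g k i _ => ∑ j with P g k i j, f g k i j := by
  simp only [Finset.sum_filter]
  exact hc.sum (.ite hP hf (.const 0))

theorem exists_ (hc : IsStable G c) {P : ∀ g, Fin (G g).n → Fin (G g).n → Fin (G g).n → Prop}
    (hP : Determined c P) : Determined c fun g k i _ => ∃ j, P g k i j := by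
  classical
  have h := (hc.sum_real (.ite hP (.const 1) (.const 0))).map fun r : ℝ => r ≠ 0
  have key : ∀ g k i, (∑ j, if P g k i j then (1 : ℝ) else 0) ≠ 0 ↔ ∃ j, P g k i j :=
    fun g k i => by
      rw [Finset.sum_boole, Nat.cast_ne_zero, Finset.card_ne_zero]
      simp [Finset.Nonempty]
  simpa only [key] using h

theorem adj (hc : IsStable G c) : Determined c fun g k i _ => (G g).graph.Adj k i := by
  classical
  intro x y h
  have := congrFun (hc.inputAt_eq x y h) (Fin.castAdd _ 0)
  simp only [inputAt, AttrGraph.tensor, Fin.append_left] at this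
  change (if (G x.1).graph.Adj (x.2 0) (x.2 1) then (1 : ℝ) else 0) =
    if (G y.1).graph.Adj (y.2 0) (y.2 1) then 1 else 0 at this
  split_ifs at this with h₁ h₂ h₂ <;> simp_all

theorem feat (hc : IsStable G c) : Determined c fun g k _ _ => (G g).feat k := by
  intro x y h
  funext a
  -- The input holds features only on its diagonal, so they are read at the triple that repeats `k`.
  have := congrFun (hc.inputAt_eq _ _ (hc.comp_eq (fun _ => 0) h)) (Fin.natAdd _ a)
  simpa [inputAt, AttrGraph.tensor] using this

/-! ### Invariant graph networks -/

/-- Lower orders embed into order 3: an input index is padded to a triple by repeating its last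
entry, and an output index is the initial part of a triple. -/
theorem equivLayer (hc : IsStable G c) {a b d d' : ℕ} (ha : 1 ≤ a ∧ a ≤ 3) (hb : b ≤ 3)
    (L : EquivLayer a d b d') (Y : ∀ g, Tensor (G g).n a d)
    (hY : ∀ x y : Triple G, c x = c y →
      Y x.1 (x.2 ∘ Fin.castLE ha.2) = Y y.1 (y.2 ∘ Fin.castLE ha.2))
    {x y : Triple G} (h : c x = c y) :
    L.eval (Y x.1) (x.2 ∘ Fin.castLE hb) = L.eval (Y y.1) (y.2 ∘ Fin.castLE hb) := by
  classical
  -- The clamp `min i (a - 1)` describes the padding and needs `a ≥ 1`. The coefficients `w` vanish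
  -- off padded triples, so each index of order `a` is counted once.
  let r : Fin 3 → Fin a := fun i => ⟨min i (a - 1), by omega⟩
  have hr : ∀ i, r (Fin.castLE ha.2 i) = i := fun i => Fin.ext (by simp [r]; omega)
  let w (e : Fin d') (f : Fin d) (S : Setoid (Fin 3 ⊕ Fin 3)) : ℝ :=
    if ∀ i, S (.inl i) (.inl (Fin.castLE ha.2 (r i))) then
      L.weight (S.comap (Sum.map (Fin.castLE ha.2) (Fin.castLE hb))) e f else 0
  have key : ∀ (z : Triple G) (e : Fin d'),
      L.eval (Y z.1) (z.2 ∘ Fin.castLE hb) e =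
        (∑ f, weightedSum (w e f) (fun z => Y z.1 (z.2 ∘ Fin.castLE ha.2) f) z) +
          L.bias ((Setoid.ker z.2).comap (Fin.castLE hb)) e := fun z e => by
    have h₁ : Setoid.ker (z.2 ∘ Fin.castLE hb) = (Setoid.ker z.2).comap (Fin.castLE hb) := by
      ext i j
      simp
    simp only [EquivLayer.eval, Pi.add_apply, Finset.sum_apply, Matrix.mulVec, dotProduct, h₁]
    rw [Finset.sum_comm]
    congr 1
    refine Finset.sum_congr rfl fun f _ => ?_
    simp only [weightedSum, w, ite_mul, zero_mul]
    rw [← Finset.sum_filter]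
    symm
    refine Finset.sum_bij' (fun p _ => p ∘ Fin.castLE ha.2) (fun p _ => p ∘ r) ?_ ?_ ?_ ?_ ?_
    · simp
    · simp [hr]
    · intro p hp
      simp only [Finset.mem_filter, Setoid.ker_def, Sum.elim_inl] at hp
      funext i
      exact (hp.2 i).symm
    · intro p _
      funext i
      simp [hr]
    · intro p _
      congr 2
      ext i j
      rcases i with i | i <;> rcases j with j | j <;> simp
  funext e
  rw [key, key, hc.ker_eq h]
  congr 1
  refine Finset.sum_congr rfl fun f _ => hc.weightedSum_eq _ _ (fun x y h => ?_) x y h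
  rw [hY x y h]

theorem ignStack (hc : IsStable G c) {a b d e : ℕ} (s : IGNStack b e a d) (ha : 1 ≤ a ∧ a ≤ 3)
    (Y : ∀ g, Tensor (G g).n a d)
    (hY : ∀ x y : Triple G, c x = c y →
      Y x.1 (x.2 ∘ Fin.castLE ha.2) = Y y.1 (y.2 ∘ Fin.castLE ha.2)) :
    ∃ hb : 1 ≤ b ∧ b ≤ 3, ∀ x y : Triple G, c x = c y →
      s.eval (Y x.1) (x.2 ∘ Fin.castLE hb.2) = s.eval (Y y.1) (y.2 ∘ Fin.castLE hb.2) := by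
  induction s with
  | last hb L => exact ⟨hb, fun x y h => hc.equivLayer ha hb.2 L Y hY h⟩
  | step hk L rest ih =>
    refine ih hk (fun g q i => relu (L.eval (Y g) q i)) fun x y h => ?_
    funext i
    exact congrArg (fun v => relu (v i)) (hc.equivLayer ha hk.2 L Y hY h)

theorem ign3 (hc : IsStable G c) {d out : ℕ} (M : IGN3 3 d out) (Y : ∀ g, Tensor (G g).n 3 d)
    (hY : ∀ x y : Triple G, c x = c y → Y x.1 x.2 = Y y.1 y.2) {x y : Triple G} (h : c x = c y) :
    M.eval (Y x.1) = M.eval (Y y.1) := by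
  obtain ⟨hb, hs⟩ := hc.ignStack M.stack (by decide) Y hY
  have := hc.equivLayer hb (by decide) M.inv (fun g => M.stack.eval (Y g)) hs h
  simp only [IGN3.eval]
  -- The invariant layer is the case `b = 0` of `equivLayer`, where all output indices coincide.
  rw [Subsingleton.elim (Fin.elim0 : Fin 0 → Fin (G x.1).n) (x.2 ∘ Fin.castLE (by decide)), this,
    Subsingleton.elim (Fin.elim0 : Fin 0 → Fin (G y.1).n) (y.2 ∘ Fin.castLE (by decide))]

end IsStable

end Determined

/-! ## Bags of subgraphs -/

section Bags

variable {ι : Type} {d₀ : ℕ} {G : ι → AttrGraph d₀} {c : Triple G → ℝ}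

/-- A colouring of the triples of nodes determines the subgraphs and the features of bags. -/
structure Bag.IsDetermined (c : Triple G → ℝ) {d : ℕ} (B : ∀ g, Bag (G g) d) : Prop where
  verts : Determined c fun g k i _ => i ∈ ((B g).sub k).verts
  adj : Determined c fun g k i j => ((B g).sub k).Adj i j
  feat : Determined c fun g k i _ => (B g).feat k i

theorem edist_le_succ_iff {V : Type*} (H : SimpleGraph V) (v u : V) (h : ℕ) :
    H.edist v u ≤ (h + 1 : ℕ) ↔ H.edist v u ≤ h ∨ ∃ w, H.edist v w ≤ h ∧ H.Adj w u := by
  constructor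
  · intro hle
    obtain ⟨p, hp⟩ := SimpleGraph.exists_walk_of_edist_ne_top
      (ne_top_of_le_ne_top (ENat.natCast_ne_top _) hle)
    rw [← hp, Nat.cast_le] at hle
    induction p using SimpleGraph.Walk.concatRec with
    | Hnil => exact .inl (by simp)
    | Hconcat q hq _ =>
      rw [SimpleGraph.Walk.length_concat] at hle
      exact .inr ⟨_, q.edist_le.trans (Nat.cast_le.2 (by omega)), hq⟩
  · rintro (hle | ⟨w, hle, hw⟩)
    · exact hle.trans (Nat.cast_le.2 h.le_succ)
    · calc H.edist v u ≤ H.edist v w + H.edist w u := SimpleGraph.edist_triangle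
        _ ≤ h + 1 := add_le_add hle (SimpleGraph.edist_eq_one_iff_adj.2 hw).le
        _ = (h + 1 : ℕ) := by simp

namespace IsStable

/-- Each further unit of distance costs one quantifier over a middle node, for which the third slot
suffices. -/
theorem edist_le (hc : IsStable G c) (h : ℕ) :
    Determined c fun g k i _ => (G g).graph.edist k i ≤ h := by
  induction h with
  | zero => simpa using hc.eq
  | succ h ih =>
    simp only [edist_le_succ_iff]
    exact ih.map₂ (hc.exists_ ((hc.subst ih 0 2 1).map₂ (hc.subst hc.adj 2 1 0) And)) Or

theorem select_verts (hc : IsStable G c) (π : Policy) :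
    Determined c fun g k i _ => i ∈ (π.select (G g).graph k).verts := by
  cases π with
  | nodeDeletion => simpa [Policy.select] using (hc.subst hc.eq 1 0 2).not
  | nodeMarking => exact .const True
  | ego h _ => exact hc.edist_le h
  | egoMarked h _ => exact hc.edist_le h

theorem select_adj (hc : IsStable G c) (π : Policy) :
    Determined c fun g k i j => (π.select (G g).graph k).Adj i j := by
  have hadj := hc.subst hc.adj 1 2 0
  cases π with
  | nodeDeletion =>
    have h₁ := (hc.subst hc.eq 1 0 2).not
    have h₂ := (hc.subst hc.eq 2 0 1).not
    simpa [Policy.select, SimpleGraph.Subgraph.deleteVerts_adj] using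
      h₁.map₂ (h₂.map₂ hadj And) And
  | nodeMarking => exact hadj
  | ego h _ =>
    exact (hc.edist_le h).map₂ ((hc.subst (hc.edist_le h) 0 2 1).map₂ hadj And) And
  | egoMarked h _ =>
    exact (hc.edist_le h).map₂ ((hc.subst (hc.edist_le h) 0 2 1).map₂ hadj And) And

theorem policy_bag (hc : IsStable G c) (zeroPad : Bool) (π : Policy) :
    Bag.IsDetermined c fun g => π.bag zeroPad (G g) := by
  classical
  refine ⟨hc.select_verts π, hc.select_adj π, ?_⟩
  have base : ∀ π : Policy, Determined c fun g k i _ => Policy.baseFeat zeroPad π (G g) k i :=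
    fun π => .ite ((Determined.const (zeroPad = true)).map₂ (hc.select_verts π).not And)
      (.const 0) (hc.subst hc.feat 1 0 2)
  have mark : Determined c fun _ k i _ => if i = k then (1 : ℝ) else 0 :=
    .ite (hc.subst hc.eq 1 0 2) (.const 1) (.const 0)
  cases π with
  | nodeDeletion => exact base _
  | nodeMarking => exact (base .nodeMarking).map₂ mark (Fin.snoc (α := fun _ => ℝ))
  | ego h hpos => exact base _
  | egoMarked h hpos => exact (base (.egoMarked h hpos)).map₂ mark (Fin.snoc (α := fun _ => ℝ))

theorem aggOn (hc : IsStable G c) {d : ℕ} {B : ∀ g, Bag (G g) d} (hB : Bag.IsDetermined c B)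
    (t : Fin 4) (s : Fin 3) : Determined c fun g k _ _ => (B g).aggOn k t s := by
  classical
  have adj₀ := hc.subst hc.adj 2 0 1
  have sub₀ := hc.subst hB.adj 0 2 0
  have diag := hc.subst hB.feat 2 2 0
  have row := hc.subst hB.feat 0 2 1
  have col := hc.subst hB.feat 2 0 1
  have ne := (hc.subst hc.eq 2 0 1).not
  fin_cases t <;> fin_cases s
  · exact hc.sum diag
  · exact hc.sum_filter sub₀ diag
  · exact hc.sum_filter adj₀ diag
  · exact hc.sum_filter ne row
  · exact hc.sum_filter sub₀ row
  · exact hc.sum_filter adj₀ row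
  · exact hc.sum_filter ne col
  · exact hc.sum_filter sub₀ col
  · exact hc.sum_filter adj₀ col
  -- In the double sums, the inner sum no longer depends on the third slot. Its root is then moved
  -- to that slot and summed over, so three slots are enough.
  · exact hc.sum (hc.subst (hc.sum_filter ne row) 2 1 0)
  · exact hc.sum_filter sub₀ (hc.subst (hc.sum_filter sub₀ row) 2 1 0)
  · exact hc.sum_filter adj₀ (hc.subst (hc.sum_filter adj₀ row) 2 1 0)

theorem aggOff (hc : IsStable G c) {d : ℕ} {B : ∀ g, Bag (G g) d} (hB : Bag.IsDetermined c B)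
    (t : Fin 6) (s : Fin 3) : Determined c fun g k i _ => (B g).aggOff k i t s := by
  classical
  have ne₀ := (hc.subst hc.eq 2 0 1).not
  have ne₁ := (hc.subst hc.eq 2 1 0).not
  have sub := hc.subst hB.adj 0 2 1
  have adj := hc.subst hc.adj 2 1 0
  have diag := hc.subst hB.feat 2 2 0
  have row₀ := hc.subst hB.feat 0 2 1
  have row₁ := hc.subst hB.feat 1 2 0
  have col₀ := hc.subst hB.feat 2 0 1
  have col₁ := hc.subst hB.feat 2 1 0
  fin_cases t <;> fin_cases s
  · exact hc.sum (hc.subst (hc.sum_filter ne₀ row₀) 2 1 0)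
  · exact hc.sum_filter sub (hc.subst (hc.sum_filter sub row₀) 2 1 0)
  · exact hc.sum_filter adj (hc.subst (hc.sum_filter adj row₀) 2 1 0)
  · exact hc.sum_filter ne₁ col₁
  · exact hc.sum_filter sub col₁
  · exact hc.sum_filter adj col₁
  · exact hc.sum_filter ne₀ row₀
  · exact hc.sum_filter sub row₀
  · exact hc.sum_filter adj row₀
  · exact hc.sum_filter ne₁ row₁
  · exact hc.sum_filter sub row₁
  · exact hc.sum_filter adj row₁
  · exact hc.sum_filter ne₀ col₀
  · exact hc.sum_filter sub col₀
  · exact hc.sum_filter adj col₀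
  · exact hc.sum diag
  · exact hc.sum_filter sub diag
  · exact hc.sum_filter adj diag

theorem pointOff (hc : IsStable G c) {d : ℕ} {B : ∀ g, Bag (G g) d} (hB : Bag.IsDetermined c B)
    (t : Fin 4) : Determined c fun g k i _ => (B g).pointOff k i t := by
  fin_cases t
  · exact hB.feat
  · exact hc.subst hB.feat 1 0 2
  · exact hc.subst hB.feat 0 0 2
  · exact hc.subst hB.feat 1 1 2

theorem reignLayer (hc : IsStable G c) {d d' : ℕ} {B : ∀ g, Bag (G g) d}
    (hB : Bag.IsDetermined c B) (L : ReIGNLayer d d') :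
    Bag.IsDetermined c fun g => L.eval (B g) := by
  refine ⟨hB.verts, hB.adj, .ite hc.eq (.add (.add ?_ ?_) (.const _)) (.add (.add ?_ ?_) (.const _))⟩
  · exact (hc.subst hB.feat 1 1 2).map _
  · refine .finset_sum _ fun t => .finset_sum _ fun s => ?_
    exact (hc.subst (hc.aggOn hB t s) 1 0 2).map (L.aggOn t s).mulVec
  · exact .finset_sum _ fun t => (hc.pointOff hB t).map _
  · exact .finset_sum _ fun t => .finset_sum _ fun s => (hc.aggOff hB t s).map _

/-- Only dependence on the colour is tracked and nothing has to be approximated, so arbitrary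
nonlinearities are harmless. -/
theorem reignStack (hc : IsStable G c) {d e : ℕ} (s : ReIGNStack e d) {B : ∀ g, Bag (G g) d}
    (hB : Bag.IsDetermined c B) : Bag.IsDetermined c fun g => s.eval (B g) := by
  induction s with
  | last L => exact hc.reignLayer hB L
  | step L σ rest ih =>
    have h := hc.reignLayer hB L
    exact ih (B := fun g => (L.eval (B g)).map σ)
      ⟨h.verts, h.adj, h.feat.map fun v a => σ (v a)⟩

theorem bag_tensor (hc : IsStable G c) {d : ℕ} {B : ∀ g, Bag (G g) d}
    (hB : Bag.IsDetermined c B) {x y : Triple G} (h : c x = c y) :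
    (B x.1).tensor x.2 = (B y.1).tensor y.2 := by
  classical
  have hdiag := hc.subst hc.eq 1 2 0
  have h₁ : Determined c fun g k i j => if ((B g).sub k).Adj i j then (1 : ℝ) else 0 :=
    .ite hB.adj (.const 1) (.const 0)
  have h₂ : Determined c fun g _ i j => if (G g).graph.Adj i j then (1 : ℝ) else 0 :=
    .ite (hc.subst hc.adj 1 2 0) (.const 1) (.const 0)
  have h₃ : Determined c fun g k i j =>
      if i = j ∧ i ∈ ((B g).sub k).verts then (1 : ℝ) else 0 :=
    .ite (hdiag.map₂ hB.verts And) (.const 1) (.const 0)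
  have h₄ : Determined c fun g k i j =>
      if i = j then Fin.append ((G g).feat i) ((B g).feat k i) else 0 :=
    .ite hdiag ((hc.subst hc.feat 1 0 2).map₂ hB.feat Fin.append) (.const 0)
  exact (h₁.map₂ (h₂.map₂ (h₃.map₂ h₄ (·, ·)) (·, ·))
    fun a b => Fin.append ![a, b.1, b.2.1] b.2.2) x y h

end IsStable

end Bags

/-! ## Separation of graphs -/

/-- On a finite family, one 3-IGN instance separates a nonempty graph from all graphs that share no
colour of triples of nodes with it. -/
theorem IsStable.exists_ign3 {ι : Type} [Finite ι] {d₀ : ℕ} {G : ι → AttrGraph d₀}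
    {c : Triple G → ℝ} (hc : IsStable G c) (b : ι) (hb : 0 < (G b).n)
    (h : ∀ x y : Triple G, c x = c y → x.1 = b → y.1 = b) :
    ∃ M : IGN3 2 (1 + d₀) 1, ∀ g, g ≠ b → M.onGraph (G g) ≠ M.onGraph (G b) := by
  classical
  obtain ⟨s, hs⟩ : Computable G fun x => ![if x.1 = b then 1 else 0] :=
    hc.computable.of_factors fun x y hxy => by
      have hxy : c x = c y := congrFun hxy 0
      simp only [(⟨h x y hxy, h y x hxy.symm⟩ : x.1 = b ↔ y.1 = b)]
  -- Summing the indicator of `b` over all triples gives `(G b).n ^ 3 > 0` on `G b` and `0` on every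
  -- other graph.
  refine ⟨⟨3, 1, 1, s, ⟨fun _ => 1, fun _ => 0⟩, .last 1 0⟩, fun g hg heq => ?_⟩
  have key : ∀ g, (⟨3, 1, 1, s, ⟨fun _ => 1, fun _ => 0⟩, .last 1 0⟩ :
      IGN3 2 (1 + d₀) 1).onGraph (G g) 0 =
        ∑ _p : Fin 3 → Fin (G g).n, if g = b then (1 : ℝ) else 0 := fun g => by
    simp only [IGN3.onGraph, IGN3.eval, MLP.eval, EquivLayer.eval, Matrix.one_mulVec, add_zero,
      Finset.sum_apply]
    exact Finset.sum_congr rfl fun p _ => congrFun (hs ⟨g, p⟩) 0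
  have := congrFun heq 0
  rw [key, key] at this
  have hpos : (0 : ℝ) < ((G b).n : ℝ) ^ 3 := by positivity
  simp [hg] at this
  exact hpos.ne this

theorem AttrGraph.isomorphic_of_n_eq_zero {d : ℕ} {G H : AttrGraph d} (hG : G.n = 0)
    (hH : H.n = 0) : G.Isomorphic H := by
  have : IsEmpty (Fin G.n) := by rw [hG]; infer_instance
  have : IsEmpty (Fin H.n) := by rw [hH]; infer_instance
  exact ⟨⟨Equiv.equivOfIsEmpty _ _, fun {v} => isEmptyElim v⟩, fun v => isEmptyElim v⟩

end SubgraphGNN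

theorem proposition1 {d₀ out : ℕ} (G₁ G₂ : SubgraphGNN.AttrGraph d₀)
    (hG : ¬ G₁.Isomorphic G₂)
    (R : SubgraphGNN.ReIGN d₀ out) (hρ : R.pool.IGN3Computable)
    (hR : R.eval G₁ ≠ R.eval G₂) :
    ∃ (out' : ℕ) (M : SubgraphGNN.IGN3 2 (1 + d₀) out'), M.onGraph G₁ ≠ M.onGraph G₂ := by
  let G : Bool → SubgraphGNN.AttrGraph d₀ := fun b => if b then G₁ else G₂
  obtain ⟨c, hc⟩ := SubgraphGNN.exists_isStable G
  let B (b : Bool) := R.stack.eval (R.policy.bag R.zeroPad (G b))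
  have hB : SubgraphGNN.Bag.IsDetermined c B :=
    hc.reignStack R.stack (hc.policy_bag R.zeroPad R.policy)
  -- Computability of the pooling is needed only on the two bags at hand.
  obtain ⟨M, hM⟩ := hρ (Set.range fun b => ⟨G b, B b⟩) (Set.finite_range _)
  have hM' : ∀ b, R.pool (G b) (B b) = M.eval (B b).tensor := fun b => hM _ ⟨b, rfl⟩
  have hne : M.eval (B true).tensor ≠ M.eval (B false).tensor := fun h =>
    hR (congrArg (R.mlp.eval R.act) ((hM' true).trans (h.trans (hM' false).symm)))
  -- A colour shared by the two graphs would force equal pooled values.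
  have hcol : ∀ x y : SubgraphGNN.Triple G, c x = c y → x.1 = y.1 := fun x y h => by
    have key := hc.ign3 M (fun b => (B b).tensor) (fun x y h => hc.bag_tensor hB h) h
    rcases x with ⟨_ | _, p⟩ <;> rcases y with ⟨_ | _, q⟩
    · rfl
    · exact absurd key.symm hne
    · exact absurd key hne
    · rfl
  have hsep : ∀ b, 0 < (G b).n → ∃ M : SubgraphGNN.IGN3 2 (1 + d₀) 1,
      ∀ g, g ≠ b → M.onGraph (G g) ≠ M.onGraph (G b) := fun b hb =>
    hc.exists_ign3 b hb fun x y h hx => (hcol x y h).symm.trans hx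
  -- An empty graph has no triples, so the indicator is taken of a nonempty one; two empty graphs
  -- are isomorphic.
  rcases Nat.eq_zero_or_pos G₁.n with h₁ | h₁
  · rcases Nat.eq_zero_or_pos G₂.n with h₂ | h₂
    · exact absurd (SubgraphGNN.AttrGraph.isomorphic_of_n_eq_zero h₁ h₂) hG
    · obtain ⟨N, hN⟩ := hsep false h₂
      exact ⟨1, N, hN true (by decide)⟩
  · obtain ⟨N, hN⟩ := hsep true h₁
    exact ⟨1, N, (hN false (by decide)).symm⟩
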